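/- Let $b\ge 3$ be an integer and let $D$ be a finite set of non-negative integers, pairwise incongruent modulo $b$, with $0\in D$ and $2\le |D|<b$. Let $\mathcal K=\{\sum_{j=0}^{k} d_j b^j : k\ge 0,\ d_j\in D\}$ be the corresponding integer Cantor set and let $k_1<k_2<\cdots$ be its increasing enumeration (so $k_1=0$). Let $(X,\mathcal A,m)$ be a probability space and let $T\colon X\to X$ be a measure-preserving map. Write $T^n g=g\circ T^n$ for functions $g$ on $X$, and suppose that the system $(X,\mathcal A,m,T)$ is compact, that is, for every $g\in L^2(X,m)$ the closure of $\{T^n g: n\in\mathbb N\}$ is a compact subset of $L^2(X,m)$. Then for every non-negative $f\in L^\infty(X,m)$, every $\varepsilon>0$ and every integer $t\ge 0$, the set $$S=\Bigl\{n\ge 1 : \int_X \prod_{s=0}^{t} T^{s k_n} f\,dm\ \ge\ \int_X f^{t+1}\,dm-\varepsilon\Bigr\}$$ has positive lower density: $\liminf_{N\to\infty} |S\cap\{1,\dots,N\}|/N>0$. -/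

import Mathlib

open MeasureTheory Filter

noncomputable section

namespace CantorCompact

/-- `b` and `D` are the base and the digit set of a classical integer Cantor set with `0 ∈ D`:
`b ≥ 3`, `2 ≤ |D| < b`, and `D` is contained in a complete collection of residues modulo `b`,
that is, its members are pairwise incongruent modulo `b`. -/
structure IsCantorDigits (b : ℕ) (D : Finset ℕ) : Prop where
  three_le_base : 3 ≤ b
  two_le_card : 2 ≤ D.card
  card_lt_base : D.card < b
  incongruent : ∀ d ∈ D, ∀ e ∈ D, d ≡ e [MOD b] → d = e
  zero_mem : 0 ∈ D

/-- The integer Cantor set of all finite sums `∑_{j=0}^k d_j b^j` with digits `d_j ∈ D`. -/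
def cantorSet (b : ℕ) (D : Finset ℕ) : Set ℕ :=
  {x | ∃ (k : ℕ) (d : ℕ → ℕ), (∀ j ≤ k, d j ∈ D) ∧ x = ∑ j ∈ Finset.range (k + 1), d j * b ^ j}

/-- The increasing enumeration `k_1 < k_2 < ⋯` of the Cantor set, indexed from `1`
(`Nat.nth` is indexed from `0`; the value at index `0` is never used). -/
def cantorSeq (b : ℕ) (D : Finset ℕ) (n : ℕ) : ℕ :=
  Nat.nth (fun x => x ∈ cantorSet b D) (n - 1)

/-- The lower density `liminf_{N → ∞} |S ∩ {1, …, N}| / N` of a set of positive integers. -/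
def lowerDensity (S : Set ℕ) : ℝ :=
  liminf (fun N : ℕ => ((S ∩ Set.Icc 1 N).ncard : ℝ) / (N : ℝ)) atTop

variable {X : Type*} [MeasurableSpace X] {μ : Measure X} {T : X → X}

/-- A function `f ∈ L²(X)` is compact if the closure of its orbit `{T^n f : n ∈ ℕ}`,
`T^n f = f ∘ T^n`, is a compact subset of `L²(X)`. -/
def IsCompactFunction (hT : MeasurePreserving T μ μ) (f : Lp ℂ 2 μ) : Prop :=
  IsCompact (closure (Set.range fun n : ℕ =>
    Lp.compMeasurePreserving (T^[n]) (hT.iterate n) f))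

/-- The system is compact if every `f ∈ L²(X)` is compact. -/
def IsCompactSystem (hT : MeasurePreserving T μ μ) : Prop :=
  ∀ f : Lp ℂ 2 μ, IsCompactFunction hT f

end CantorCompact

end

/-! Fix `F = f` in `L²` and let `R` be the set of `r` with `‖T^r F - F‖ < η`. Compactness of the
orbit closure makes two partial sums of any sequence `u` act almost equally on `F`; as `T` acts
isometrically, their difference, a sum of consecutive terms, lies in `R`
(`exists_sum_Ico_returnDist_lt`). Stacking digit blocks then gives one `J` such that every `y ∈ K`
has a `J`-digit `s` with `s + b^J y ∈ R` (`exists_digitSums_forall_add_mem`). The map `y ↦ s + b^J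
y` is injective from `K` to `K ∩ R` and stretches indices at most linearly, so `k_n ∈ R` with
positive lower density. For such `n` every `T^{s k_n} f`, `s ≤ t`, is `L¹`-close to `f`, hence the
product is close to `f^{t+1}`. -/

namespace CantorCompact

/-! ### Digit blocks and the Cantor set -/

/-- The sums `∑_{j < J} d_j b^j` with digits `d_j ∈ D`. -/
def digitSums (b : ℕ) (D : Finset ℕ) : ℕ → Finset ℕ
  | 0 => {0}
  | J + 1 => Finset.image₂ (fun s d => s + d * b ^ J) (digitSums b D J) D

theorem mem_digitSums_succ {b : ℕ} {D : Finset ℕ} {J x : ℕ} :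
    x ∈ digitSums b D (J + 1) ↔ ∃ s ∈ digitSums b D J, ∃ d ∈ D, s + d * b ^ J = x := by
  simp [digitSums, Finset.mem_image₂]

theorem sum_mem_digitSums {b : ℕ} {D : Finset ℕ} {d : ℕ → ℕ} (J : ℕ) (hd : ∀ j < J, d j ∈ D) :
    ∑ j ∈ Finset.range J, d j * b ^ j ∈ digitSums b D J := by
  induction J with
  | zero => simp [digitSums]
  | succ J ih =>
    rw [Finset.sum_range_succ, mem_digitSums_succ]
    exact ⟨_, ih fun j hj => hd j (by omega), _, hd J (by omega), rfl⟩

theorem exists_digits_of_mem_digitSums {b : ℕ} {D : Finset ℕ} {J x : ℕ}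
    (h0 : 0 ∈ D) (hx : x ∈ digitSums b D J) :
    ∃ d : ℕ → ℕ, (∀ j, d j ∈ D) ∧ x = ∑ j ∈ Finset.range J, d j * b ^ j := by
  induction J generalizing x with
  | zero => exact ⟨fun _ => 0, fun _ => h0, by simpa [digitSums] using hx⟩
  | succ J ih =>
    obtain ⟨s, hs, e, he, rfl⟩ := mem_digitSums_succ.1 hx
    obtain ⟨d, hd, rfl⟩ := ih hs
    refine ⟨Function.update d J e, fun j => ?_, ?_⟩
    · by_cases h : j = J
      · simpa [h] using he
      · simpa [h] using hd j
    · rw [Finset.sum_range_succ, Function.update_self]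
      congr 1
      refine Finset.sum_congr rfl fun j hj => ?_
      rw [Function.update_of_ne (Finset.mem_range.1 hj).ne]

theorem digitSums_subset_succ {b : ℕ} {D : Finset ℕ} (h0 : 0 ∈ D) (J : ℕ) :
    digitSums b D J ⊆ digitSums b D (J + 1) := fun x hx =>
  mem_digitSums_succ.2 ⟨x, hx, 0, h0, by simp⟩

theorem mem_cantorSet_iff {b : ℕ} {D : Finset ℕ} (h0 : 0 ∈ D) {x : ℕ} :
    x ∈ cantorSet b D ↔ ∃ J, x ∈ digitSums b D J := by
  constructor
  · rintro ⟨k, d, hd, rfl⟩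
    exact ⟨k + 1, sum_mem_digitSums _ fun j hj => hd j (by omega)⟩
  · rintro ⟨J, hx⟩
    obtain ⟨d, hd, h⟩ := exists_digits_of_mem_digitSums h0 (digitSums_subset_succ h0 J hx)
    exact ⟨J, d, fun j _ => hd j, h⟩

theorem add_pow_mul_mem_digitSums {b : ℕ} {D : Finset ℕ} {J I s y : ℕ}
    (hs : s ∈ digitSums b D J) (hy : y ∈ digitSums b D I) :
    s + b ^ J * y ∈ digitSums b D (J + I) := by
  induction I generalizing y with
  | zero =>
    obtain rfl : y = 0 := by simpa [digitSums] using hy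
    simpa using hs
  | succ I ih =>
    obtain ⟨z, hz, d, hd, rfl⟩ := mem_digitSums_succ.1 hy
    exact mem_digitSums_succ.2 ⟨_, ih hz, d, hd, by rw [Nat.add_eq, pow_add]; ring⟩

theorem exists_split_of_mem_digitSums {b : ℕ} {D : Finset ℕ} {J I x : ℕ}
    (hx : x ∈ digitSums b D (J + I)) :
    ∃ s ∈ digitSums b D J, ∃ y ∈ digitSums b D I, x = s + b ^ J * y := by
  induction I generalizing x with
  | zero => exact ⟨x, hx, 0, by simp [digitSums], by simp⟩
  | succ I ih =>
    obtain ⟨z, hz, d, hd, rfl⟩ := mem_digitSums_succ.1 (show x ∈ digitSums b D (J + I + 1) from hx)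
    obtain ⟨s, hs, y, hy, rfl⟩ := ih hz
    exact ⟨s, hs, _, mem_digitSums_succ.2 ⟨y, hy, d, hd, rfl⟩, by ring⟩

/-- Reduction modulo `b ^ J` discards the top digit; once the lower parts agree they cancel, leaving
a congruence of digits modulo `b`. -/
theorem digitSums_modEq_injective {b : ℕ} {D : Finset ℕ} (hD : IsCantorDigits b D) {J s s' : ℕ}
    (hs : s ∈ digitSums b D J) (hs' : s' ∈ digitSums b D J) (h : s ≡ s' [MOD b ^ J]) : s = s' := by
  induction J generalizing s s' with
  | zero =>
    simp only [digitSums, Finset.mem_singleton] at hs hs'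
    rw [hs, hs']
  | succ J ih =>
    obtain ⟨z, hz, d, hd, rfl⟩ := mem_digitSums_succ.1 hs
    obtain ⟨z', hz', d', hd', rfl⟩ := mem_digitSums_succ.1 hs'
    have hb : 0 < b ^ J := pow_pos (by have := hD.three_le_base; omega) _
    have h1 : z ≡ z' [MOD b ^ J] := by
      have h2 := h.of_dvd (pow_dvd_pow b (Nat.le_succ J))
      simpa [Nat.ModEq] using h2
    obtain rfl := ih hz hz' h1
    have h3 : d * b ^ J ≡ d' * b ^ J [MOD b ^ (J + 1)] := Nat.ModEq.add_left_cancel' z h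
    rw [pow_succ', Nat.ModEq.mul_right_cancel_iff' hb.ne'] at h3
    rw [hD.incongruent d hd d' hd' h3]

theorem card_digitSums_le (b : ℕ) (D : Finset ℕ) (J : ℕ) : (digitSums b D J).card ≤ D.card ^ J := by
  induction J with
  | zero => simp [digitSums]
  | succ J ih =>
    rw [pow_succ]
    exact (Finset.card_image₂_le _ _ _).trans (Nat.mul_le_mul_right _ ih)

theorem add_pow_mul_mem_cantorSet {b : ℕ} {D : Finset ℕ} (h0 : 0 ∈ D) {J s y : ℕ}
    (hs : s ∈ digitSums b D J) (hy : y ∈ cantorSet b D) : s + b ^ J * y ∈ cantorSet b D := by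
  obtain ⟨I, hI⟩ := (mem_cantorSet_iff h0).1 hy
  exact (mem_cantorSet_iff h0).2 ⟨_, add_pow_mul_mem_digitSums hs hI⟩

theorem exists_split_of_mem_cantorSet {b : ℕ} {D : Finset ℕ} (h0 : 0 ∈ D) (J : ℕ) {x : ℕ}
    (hx : x ∈ cantorSet b D) :
    ∃ s ∈ digitSums b D J, ∃ y ∈ cantorSet b D, x = s + b ^ J * y := by
  obtain ⟨I, hI⟩ := (mem_cantorSet_iff h0).1 hx
  have hx' : x ∈ digitSums b D (J + I) := by
    rw [add_comm]
    exact monotone_nat_of_le_succ (digitSums_subset_succ (b := b) h0) (Nat.le_add_right I J) hI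
  obtain ⟨s, hs, y, hy, h⟩ := exists_split_of_mem_digitSums hx'
  exact ⟨s, hs, y, (mem_cantorSet_iff h0).2 ⟨I, hy⟩, h⟩

theorem cantorSet_infinite {b : ℕ} {D : Finset ℕ} (hD : IsCantorDigits b D) :
    (Set.ofPred fun x => x ∈ cantorSet b D).Infinite := by
  obtain ⟨d, hd, hd0⟩ := Finset.exists_mem_ne (s := D) (by have := hD.two_le_card; omega) 0
  have hb := hD.three_le_base
  refine Set.infinite_of_injective_forall_mem (f := fun J : ℕ => 0 + d * b ^ J) ?_ fun J => ?_
  · intro i j hij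
    simp only [zero_add] at hij
    exact Nat.pow_right_injective (by omega) (Nat.eq_of_mul_eq_mul_left (by omega) hij)
  · refine (mem_cantorSet_iff hD.zero_mem).2 ⟨J + 1, mem_digitSums_succ.2 ⟨0, ?_, d, hd, rfl⟩⟩
    exact monotone_nat_of_le_succ (digitSums_subset_succ (b := b) hD.zero_mem) (Nat.zero_le J)
      (by simp [digitSums])

/-- If `R` contains a sum over consecutive terms of every sequence, then a bounded number of
low digits suffices to move any element of the Cantor set into `R`. -/
theorem exists_digitSums_forall_add_mem {b : ℕ} {D : Finset ℕ} (h0 : 0 ∈ D) {R : Set ℕ}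
    (hR : ∀ u : ℕ → ℕ, ∃ i j, i < j ∧ ∑ l ∈ Finset.Ico i j, u l ∈ R) :
    ∃ J, ∀ y ∈ cantorSet b D, ∃ s ∈ digitSums b D J, s + b ^ J * y ∈ R := by
  by_contra! hcon
  choose Y hY hYR using hcon
  choose I hI using fun J => (mem_cantorSet_iff h0).1 (hY J)
  -- `Y J` fails for `J` low digits and has `I J` digits, so the next block starts at `J + I J`,
  -- clear of it.
  let q : ℕ → ℕ := fun n => Nat.rec 0 (fun _ J => J + I J) n
  have hq : ∀ n, q (n + 1) = q n + I (q n) := fun n => rfl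
  have hmem : ∀ i m, ∑ l ∈ Finset.Ico i (i + m), b ^ q l * Y (q l) ∈ digitSums b D (q (i + m)) := by
    intro i m
    induction m with
    | zero =>
      simpa using monotone_nat_of_le_succ (digitSums_subset_succ (b := b) h0) (Nat.zero_le (q i))
        (show 0 ∈ digitSums b D 0 by simp [digitSums])
    | succ m ih =>
      rw [← add_assoc, Finset.sum_Ico_succ_top (Nat.le_add_right i m), hq]
      exact add_pow_mul_mem_digitSums ih (hI _)
  obtain ⟨i, j, hij, h⟩ := hR fun l => b ^ q l * Y (q l)
  obtain ⟨m, rfl⟩ := Nat.exists_eq_add_of_lt hij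
  -- All terms but the last form an admissible low part for the last block, contradicting its
  -- choice.
  rw [Finset.sum_Ico_succ_top (Nat.le_add_right i m)] at h
  exact hYR _ _ (hmem i m) h

/-! ### Lower density along the enumeration -/

theorem lowerDensity_pos_of_injective {S : Set ℕ} {φ : ℕ → ℕ} (hφ : Function.Injective φ)
    (hS : ∀ n, φ n ∈ S) (h1 : ∀ n, 1 ≤ φ n) {c C : ℕ} (hc : 0 < c) (hle : ∀ n, φ n ≤ c * (n + C)) :
    0 < lowerDensity S := by
  have hfin : ∀ N, (S ∩ Set.Icc 1 N).Finite := fun N => (Set.finite_Icc 1 N).inter_of_right S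
  -- A real `liminf` is meaningful only with a bound; this one supplies coboundedness.
  have hbound : ∀ N, ((S ∩ Set.Icc 1 N).ncard : ℝ) / (N : ℝ) ≤ 1 := by
    intro N
    refine div_le_one_of_le₀ ?_ (Nat.cast_nonneg N)
    have := Set.ncard_le_ncard (s := S ∩ Set.Icc 1 N) Set.inter_subset_right (Set.finite_Icc 1 N)
    rw [Set.ncard_eq_toFinset_card' (Set.Icc 1 N)] at this
    exact_mod_cast this.trans (by simp)
  have hc' : (0 : ℝ) < c := by exact_mod_cast hc
  refine lt_of_lt_of_le (show (0 : ℝ) < 1 / (2 * c) by positivity) ?_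
  refine le_liminf_of_le (isBoundedUnder_of ⟨1, hbound⟩).isCoboundedUnder_ge ?_
  -- From here on `C + 1 ≤ N / (2c)`, so at least `N / c - 1 - C ≥ N / (2c)` values of `φ` are at
  -- most `N`.
  filter_upwards [eventually_ge_atTop (2 * c * (C + 1) + 1)] with N hN
  have hN0 : (0 : ℝ) < N := by exact_mod_cast (by omega : 0 < N)
  have hsub : ((Finset.range (N / c - C)).image φ : Set ℕ) ⊆ S ∩ Set.Icc 1 N := by
    intro x hx
    obtain ⟨n, hn, rfl⟩ := Finset.mem_image.1 (Finset.mem_coe.1 hx)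
    have hn' := Finset.mem_range.1 hn
    refine ⟨hS n, h1 n, (hle n).trans ?_⟩
    exact (Nat.mul_le_mul_left c (by omega : n + C ≤ N / c)).trans (Nat.mul_div_le N c)
  have hcard := Set.ncard_le_ncard hsub (hfin N)
  rw [Set.ncard_coe_finset, Finset.card_image_of_injective _ hφ, Finset.card_range] at hcard
  have hdiv : (N : ℝ) / c < ((N / c : ℕ) : ℝ) + 1 := by
    rw [div_lt_iff₀ hc']
    exact_mod_cast (by simpa [mul_comm] using Nat.lt_mul_div_succ N hc)
  have hcard' : ((N / c : ℕ) : ℝ) ≤ (S ∩ Set.Icc 1 N).ncard + C := by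
    exact_mod_cast (by omega : N / c ≤ (S ∩ Set.Icc 1 N).ncard + C)
  have hN' : 2 * (c : ℝ) * (C + 1) ≤ N := by exact_mod_cast (by omega : 2 * c * (C + 1) ≤ N)
  rw [le_div_iff₀ hN0]
  have h2 : (C : ℝ) + 1 ≤ N / c / 2 := by
    rw [div_div, le_div_iff₀ (by positivity)]
    linarith
  have h3 : 1 / (2 * (c : ℝ)) * N = N / c / 2 := by
    field_simp
  rw [h3]
  linarith

/-- Along the enumeration of the Cantor set, such an `R` is hit with positive lower density. -/
theorem lowerDensity_cantorSeq_pos {b : ℕ} {D : Finset ℕ} (hD : IsCantorDigits b D) {R : Set ℕ}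
    (hR : ∀ u : ℕ → ℕ, ∃ i j, i < j ∧ ∑ l ∈ Finset.Ico i j, u l ∈ R) {S : Set ℕ}
    (hS : ∀ n, 1 ≤ n → cantorSeq b D n ∈ R → n ∈ S) : 0 < lowerDensity S := by
  classical
  obtain ⟨J, hJ⟩ := exists_digitSums_forall_add_mem (b := b) hD.zero_mem hR
  choose! σ hσ hσR using hJ
  set p : ℕ → Prop := fun x => x ∈ cantorSet b D with hp
  have hinf : (Set.ofPred p).Infinite := cantorSet_infinite hD
  have hk : ∀ n, Nat.nth p n ∈ cantorSet b D := fun n => Nat.nth_mem_of_infinite hinf n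
  have hb : 0 < b ^ J := pow_pos (by have := hD.three_le_base; omega) _
  set z : ℕ → ℕ := fun n => σ (Nat.nth p n) + b ^ J * Nat.nth p n with hz
  have hzK : ∀ n, p (z n) := fun n => add_pow_mul_mem_cantorSet hD.zero_mem (hσ _ (hk n)) (hk n)
  have hzinj : Function.Injective z := by
    intro n m h
    have hmod : σ (Nat.nth p n) ≡ σ (Nat.nth p m) [MOD b ^ J] := by
      have : z n ≡ z m [MOD b ^ J] := by rw [h]
      simpa [hz, Nat.ModEq] using this
    have hσeq := digitSums_modEq_injective hD (hσ _ (hk n)) (hσ _ (hk m)) hmod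
    simp only [hz, hσeq, add_right_inj] at h
    exact Nat.nth_injective hinf (Nat.eq_of_mul_eq_mul_left hb h)
  set A := (digitSums b D J).sup id with hA
  have hAle : ∀ s ∈ digitSums b D J, s ≤ A := fun s hs => Finset.le_sup (f := id) hs
  -- An element `s + b^J y` of `K` up to `z n` has `y ≤ k + A`, where `k = Nat.nth p n`; this allows
  -- at most `n + A + 1` values of `y`.
  have hcount : ∀ n, Nat.count p (z n + 1) ≤ D.card ^ J * (n + (A + 1)) := by
    intro n
    have hsub : (Finset.range (z n + 1)).filter p ⊆
        Finset.image₂ (fun s y => s + b ^ J * y) (digitSums b D J)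
          ((Finset.range (Nat.nth p n + (A + 1))).filter p) := by
      intro x hx
      obtain ⟨hx1, hx2⟩ := Finset.mem_filter.1 hx
      obtain ⟨s, hs, y, hy, rfl⟩ := exists_split_of_mem_cantorSet hD.zero_mem J hx2
      refine Finset.mem_image₂.2 ⟨s, hs, y, Finset.mem_filter.2 ⟨?_, hy⟩, rfl⟩
      rw [Finset.mem_range] at hx1 ⊢
      by_contra! hlt
      have h1 : b ^ J * (Nat.nth p n + (A + 1)) ≤ b ^ J * y := Nat.mul_le_mul_left _ hlt
      have h2 : A + 1 ≤ b ^ J * (A + 1) := Nat.le_mul_of_pos_left _ hb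
      have h3 := hAle _ (hσ _ (hk n))
      rw [mul_add] at h1
      simp only [hz] at hx1
      omega
    rw [Nat.count_eq_card_filter_range]
    refine (Finset.card_le_card hsub).trans ((Finset.card_image₂_le _ _ _).trans ?_)
    refine Nat.mul_le_mul (card_digitSums_le b D J) ?_
    rw [← Nat.count_eq_card_filter_range, Nat.count_add, Nat.count_nth_of_infinite hinf]
    exact Nat.add_le_add_left (Nat.count_le _) _
  have hseq : ∀ n, cantorSeq b D (Nat.count p (z n) + 1) = z n := by
    intro n
    exact Nat.nth_count (hzK n)
  refine lowerDensity_pos_of_injective (φ := fun n => Nat.count p (z n) + 1)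
    (c := D.card ^ J) (C := A + 1) ?_ ?_ (fun n => by simp) ?_ ?_
  · intro n m h
    apply hzinj
    rw [← hseq n, ← hseq m]
    exact congrArg _ h
  · intro n
    refine hS _ (by simp) ?_
    rw [hseq]
    exact hσR _ (hk n)
  · exact pow_pos (by have := hD.two_le_card; omega) _
  · intro n
    refine le_trans (le_of_eq ?_) (hcount n)
    rw [Nat.count_succ, if_pos (hzK n)]

/-! ### From return times to the integral -/

theorem abs_prod_sub_pow_le {M c : ℝ} (hM : 1 ≤ M) (hc : |c| ≤ M) {a : ℕ → ℝ} (n : ℕ)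
    (ha : ∀ s < n, |a s| ≤ M) :
    |∏ s ∈ Finset.range n, a s - c ^ n| ≤ M ^ n * ∑ s ∈ Finset.range n, |a s - c| := by
  induction n with
  | zero => simp
  | succ n ih =>
    have hM0 : 0 ≤ M := by linarith
    have ih' := ih fun s hs => ha s (by omega)
    rw [Finset.prod_range_succ, Finset.sum_range_succ]
    have hsplit : (∏ s ∈ Finset.range n, a s) * a n - c ^ (n + 1) =
        (∏ s ∈ Finset.range n, a s - c ^ n) * a n + c ^ n * (a n - c) := by ring
    rw [hsplit]
    refine (abs_add_le _ _).trans ?_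
    rw [abs_mul, abs_mul, abs_pow]
    have h1 := mul_le_mul ih' (ha n (by omega)) (abs_nonneg _)
      (mul_nonneg (pow_nonneg hM0 n) (Finset.sum_nonneg fun s _ => abs_nonneg (a s - c)))
    have h2 : |c| ^ n ≤ M ^ (n + 1) :=
      (pow_le_pow_left₀ (abs_nonneg c) hc n).trans (pow_le_pow_right₀ hM (Nat.le_succ n))
    have h3 := mul_le_mul_of_nonneg_right h2 (abs_nonneg (a n - c))
    calc _ ≤ _ := add_le_add h1 h3
      _ = _ := by ring

section Dynamics

variable {X : Type*} [MeasurableSpace X] {μ : Measure X} {T : X → X}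

/-- The `L²` distance between `F` and its translate `F ∘ T^r`. -/
noncomputable def returnDist (hT : MeasurePreserving T μ μ) (F : Lp ℂ 2 μ) (r : ℕ) : ℝ :=
  dist (Lp.compMeasurePreserving (T^[r]) (hT.iterate r) F) F

theorem compMeasurePreserving_iterate_add (hT : MeasurePreserving T μ μ) (F : Lp ℂ 2 μ)
    (r s : ℕ) :
    Lp.compMeasurePreserving (T^[r + s]) (hT.iterate (r + s)) F =
      Lp.compMeasurePreserving (T^[s]) (hT.iterate s)
        (Lp.compMeasurePreserving (T^[r]) (hT.iterate r) F) := by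
  apply Lp.ext
  have h1 := Lp.coeFn_compMeasurePreserving F (hT.iterate (r + s))
  have h2 := Lp.coeFn_compMeasurePreserving
    (Lp.compMeasurePreserving (T^[r]) (hT.iterate r) F) (hT.iterate s)
  have h3 := (hT.iterate s).quasiMeasurePreserving.ae_eq_comp
    (Lp.coeFn_compMeasurePreserving F (hT.iterate r))
  filter_upwards [h1, h2, h3] with x hx1 hx2 hx3
  rw [hx1, hx2, hx3, Function.iterate_add]
  rfl

theorem dist_compMeasurePreserving_iterate_add (hT : MeasurePreserving T μ μ) (F : Lp ℂ 2 μ)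
    (r s : ℕ) :
    dist (Lp.compMeasurePreserving (T^[r + s]) (hT.iterate (r + s)) F)
      (Lp.compMeasurePreserving (T^[s]) (hT.iterate s) F) = returnDist hT F r := by
  rw [compMeasurePreserving_iterate_add hT]
  exact (Lp.isometry_compMeasurePreserving (hT.iterate s)).dist_eq _ _

/-- Each of the `s` steps of length `k` costs the same, by isometry. -/
theorem returnDist_mul_le (hT : MeasurePreserving T μ μ) (F : Lp ℂ 2 μ) (k s : ℕ) :
    returnDist hT F (s * k) ≤ s * returnDist hT F k := by
  induction s with
  | zero =>
    simp [returnDist]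
  | succ s ih =>
    have h := dist_compMeasurePreserving_iterate_add hT F k (s * k)
    have heq : (s + 1) * k = k + s * k := by ring
    rw [heq, returnDist]
    refine (dist_triangle _ (Lp.compMeasurePreserving (T^[s * k]) (hT.iterate (s * k)) F) _).trans ?_
    rw [h]
    push_cast
    unfold returnDist at ih ⊢
    linarith

theorem exists_sum_Ico_returnDist_lt (hT : MeasurePreserving T μ μ) {F : Lp ℂ 2 μ}
    (hF : IsCompactFunction hT F) {η : ℝ} (hη : 0 < η) (u : ℕ → ℕ) :
    ∃ i j, i < j ∧ returnDist hT F (∑ l ∈ Finset.Ico i j, u l) < η := by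
  let v : ℕ → Lp ℂ 2 μ := fun n =>
    Lp.compMeasurePreserving (T^[n]) (hT.iterate n) F
  obtain ⟨_, _, φ, hφ, hlim⟩ := hF.tendsto_subseq
    (x := fun n => v (∑ l ∈ Finset.range n, u l)) fun n => subset_closure ⟨_, rfl⟩
  obtain ⟨N, hN⟩ := Metric.cauchySeq_iff'.1 hlim.cauchySeq η hη
  refine ⟨φ N, φ (N + 1), hφ (Nat.lt_succ_self N), ?_⟩
  have h := hN (N + 1) (Nat.le_succ N)
  have hle : φ N ≤ φ (N + 1) := (hφ (Nat.lt_succ_self N)).le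
  simp only [Function.comp_apply] at h
  rw [← Finset.sum_range_add_sum_Ico u hle, add_comm] at h
  rwa [← dist_compMeasurePreserving_iterate_add hT F]

theorem integral_abs_comp_sub_le_returnDist [IsProbabilityMeasure μ]
    (hT : MeasurePreserving T μ μ) {f : X → ℝ} {F : Lp ℂ 2 μ} (hF : F =ᵐ[μ] fun x => (f x : ℂ))
    (r : ℕ) : ∫ x, |f (T^[r] x) - f x| ∂μ ≤ returnDist hT F r := by
  set G := Lp.compMeasurePreserving (T^[r]) (hT.iterate r) F - F with hG
  have hae : (fun x => |f (T^[r] x) - f x|) =ᵐ[μ] fun x => ‖G x‖ := by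
    filter_upwards [Lp.coeFn_sub (Lp.compMeasurePreserving (T^[r]) (hT.iterate r) F) F,
      Lp.coeFn_compMeasurePreserving F (hT.iterate r),
      (hT.iterate r).quasiMeasurePreserving.ae_eq_comp hF, hF] with x h1 h2 h3 h4
    rw [h1, Pi.sub_apply, h2, h3, h4, Function.comp_apply, ← Complex.ofReal_sub,
      Complex.norm_real, Real.norm_eq_abs]
  have hGm : AEStronglyMeasurable G μ := Lp.aestronglyMeasurable G
  rw [integral_congr_ae hae, integral_norm_eq_lintegral_enorm hGm, ← eLpNorm_one_eq_lintegral_enorm,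
    returnDist, dist_eq_norm, Lp.norm_def]
  -- On a probability space the `L¹` norm is at most the `L²` norm.
  exact ENNReal.toReal_mono (Lp.eLpNorm_ne_top G)
    (eLpNorm_le_eLpNorm_of_exponent_le (by norm_num) hGm)

theorem integral_pow_sub_integral_prod_le [IsProbabilityMeasure μ]
    (hT : MeasurePreserving T μ μ) {f : X → ℝ} {F : Lp ℂ 2 μ} (hF : F =ᵐ[μ] fun x => (f x : ℂ))
    (hf : AEStronglyMeasurable f μ) {M : ℝ} (hM : 1 ≤ M) (hfM : ∀ᵐ x ∂μ, |f x| ≤ M) (t k : ℕ) :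
    (∫ x, f x ^ t ∂μ) - ∫ x, ∏ s ∈ Finset.range t, f (T^[s * k] x) ∂μ ≤
      M ^ t * (t * t * returnDist hT F k) := by
  have hm : ∀ s, AEStronglyMeasurable (fun x => f (T^[s * k] x)) μ := fun s =>
    hf.comp_measurePreserving (hT.iterate (s * k))
  have hMs : ∀ᵐ x ∂μ, ∀ s : ℕ, |f (T^[s * k] x)| ≤ M :=
    ae_all_iff.2 fun s => (hT.iterate (s * k)).quasiMeasurePreserving.ae hfM
  have hint : ∀ s, Integrable (fun x => f (T^[s * k] x)) μ := fun s =>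
    Integrable.of_bound (hm s) M (hMs.mono fun x hx => hx s)
  have hintf : Integrable f μ := Integrable.of_bound hf M hfM
  have hintpow : Integrable (fun x => f x ^ t) μ := by
    refine Integrable.of_bound (hf.pow t) (M ^ t) (hfM.mono fun x hx => ?_)
    rw [norm_pow]
    exact pow_le_pow_left₀ (norm_nonneg _) hx t
  have hintprod : Integrable (fun x => ∏ s ∈ Finset.range t, f (T^[s * k] x)) μ := by
    refine Integrable.of_bound (Finset.aestronglyMeasurable_fun_prod _ fun s _ => hm s) (M ^ t)
      (hMs.mono fun x hx => ?_)
    rw [norm_prod]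
    refine (Finset.prod_le_prod (fun s _ => norm_nonneg _) fun s _ => hx s).trans ?_
    simp
  have hdiff : ∀ s, Integrable (fun x => |f (T^[s * k] x) - f x|) μ := fun s =>
    ((hint s).sub hintf).abs
  rw [← integral_sub hintpow hintprod]
  calc ∫ x, (f x ^ t - ∏ s ∈ Finset.range t, f (T^[s * k] x)) ∂μ
      ≤ ∫ x, M ^ t * ∑ s ∈ Finset.range t, |f (T^[s * k] x) - f x| ∂μ := by
        refine integral_mono_ae (hintpow.sub hintprod)
          ((integrable_finsetSum _ fun s _ => hdiff s).const_mul _) ?_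
        filter_upwards [hfM, hMs] with x hx hxs
        refine le_trans ?_ (abs_prod_sub_pow_le hM hx t fun s _ => hxs s)
        rw [abs_sub_comm]
        exact le_abs_self _
    _ = M ^ t * ∑ s ∈ Finset.range t, ∫ x, |f (T^[s * k] x) - f x| ∂μ := by
        rw [integral_const_mul, integral_finsetSum _ fun s _ => hdiff s]
    _ ≤ M ^ t * (t * t * returnDist hT F k) := by
        refine mul_le_mul_of_nonneg_left ?_ (by positivity)
        have hs : ∀ s ∈ Finset.range t,
            ∫ x, |f (T^[s * k] x) - f x| ∂μ ≤ t * returnDist hT F k := by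
          intro s hs
          refine (integral_abs_comp_sub_le_returnDist hT hF _).trans
            ((returnDist_mul_le hT F k s).trans ?_)
          refine mul_le_mul_of_nonneg_right ?_ dist_nonneg
          exact_mod_cast (Finset.mem_range.1 hs).le
        -- One factor `t` counts the terms; the other bounds the multiplier `s < t`.
        refine (Finset.sum_le_card_nsmul _ _ _ hs).trans (le_of_eq ?_)
        rw [Finset.card_range, nsmul_eq_mul, mul_assoc]

end Dynamics

end CantorCompact

theorem mainTheorem7 {X : Type*} [MeasurableSpace X] (μ : Measure X) [IsProbabilityMeasure μ]
    (T : X → X) (hT : MeasurePreserving T μ μ) (hcompact : CantorCompact.IsCompactSystem hT)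
    (b : ℕ) (D : Finset ℕ) (hD : CantorCompact.IsCantorDigits b D)
    (f : X → ℝ) (hf : MemLp f ⊤ μ) (hf_nonneg : 0 ≤ᵐ[μ] f)
    (ε : ℝ) (hε : 0 < ε) (t : ℕ) :
    0 < CantorCompact.lowerDensity {n : ℕ | 1 ≤ n ∧
      (∫ x, f x ^ (t + 1) ∂μ) - ε ≤
        ∫ x, ∏ s ∈ Finset.range (t + 1), f (T^[s * CantorCompact.cantorSeq b D n] x) ∂μ} := by
  have hf2 : MemLp (fun x => (f x : ℂ)) 2 μ := (hf.mono_exponent le_top).ofReal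
  obtain ⟨M, hM1, hM⟩ : ∃ M : ℝ, 1 ≤ M ∧ ∀ᵐ x ∂μ, |f x| ≤ M := by
    refine ⟨max 1 (eLpNorm f ⊤ μ).toReal, le_max_left _ _, ?_⟩
    filter_upwards [ae_le_eLpNormEssSup (f := f) (μ := μ)] with x hx
    refine le_max_of_le_right ?_
    rw [← eLpNorm_exponent_top] at hx
    have := ENNReal.toReal_mono hf.eLpNorm_ne_top hx
    simpa using this
  have hK : 0 < M ^ (t + 1) * (((t + 1 : ℕ) : ℝ) * ((t + 1 : ℕ) : ℝ)) := by positivity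
  set F := hf2.toLp
  -- This radius makes the error for `t + 1` factors less than `ε`.
  refine CantorCompact.lowerDensity_cantorSeq_pos hD
    (R := {r | CantorCompact.returnDist hT F r <
      ε / (M ^ (t + 1) * (((t + 1 : ℕ) : ℝ) * ((t + 1 : ℕ) : ℝ)))})
    (CantorCompact.exists_sum_Ico_returnDist_lt hT (hcompact F) (div_pos hε hK))
    (fun n hn hr => ⟨hn, ?_⟩)
  have h := CantorCompact.integral_pow_sub_integral_prod_le hT hf2.coeFn_toLp hf.1 hM1 hM (t + 1)
    (CantorCompact.cantorSeq b D n)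
  have hr' : CantorCompact.returnDist hT F (CantorCompact.cantorSeq b D n) < _ := hr
  rw [lt_div_iff₀ hK] at hr'
  have h' : M ^ (t + 1) * (((t + 1 : ℕ) : ℝ) * ((t + 1 : ℕ) : ℝ) *
      CantorCompact.returnDist hT F (CantorCompact.cantorSeq b D n)) < ε := by
    linarith
  linarith [h.trans h'.le]
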